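/- Let $(\mathcal M,g)$ be a smooth Lorentzian manifold (Hausdorff, second countable, of signature $(-,+,\dots,+)$) that is strongly causal and time-orientable, with time orientation given by a smooth timelike vector field $T$. A nonzero causal tangent vector $v$ ($g(v,v)\le 0$) is future directed if $g(v,T)<0$. Strongly causal means that every point has arbitrarily small neighborhoods that every future directed timelike curve meets at most once (that is, in a connected set of parameters). Write $p\preceq q$ if $p=q$ or there is a future directed causal piecewise smooth curve from $p$ to $q$. Let $$d(p,q)=\sup\Big\{\int_0^1\sqrt{-g(\dot\gamma(t),\dot\gamma(t))}\,dt\Big\}\in[0,+\infty],$$ the supremum being over all future directed causal piecewise smooth curves $\gamma:[0,1]\to\mathcal M$ from $p$ to $q$ (and $d(p,q)=0$ if there is none). Let $\mathcal C(\mathcal M)$ be the set of causal functions, i.e. continuous functions $f:\mathcal M\to\mathbb R$ that are non-decreasing along every future directed causal curve. **Theorem.** For all $p,q\in\mathcal M$ with $p\preceq q$, $$d(p,q)\ \le\ \inf\big\{\,f(q)-f(p)\ :\ f\in\mathcal C(\mathcal M),\ f\text{ is differentiable almost everywhere and } \operatorname{ess\,sup}\, g(\nabla f,\nabla f)\le -1\,\big\},$$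 where almost everywhere and $\operatorname{ess\,sup}$ refer to the measure class of Lebesgue measure in charts, and the infimum of the empty set is $+\infty$. -/

import Mathlib

open scoped Manifold ContDiff

noncomputable section

/-- A smooth Lorentzian metric of signature `(-,+,...,+)` on an `n`-dimensional smooth manifold:
a smooth field of symmetric bilinear forms on the tangent spaces, each of which has a negative
vector whose orthogonal complement is positive definite. -/
structure LorentzianMetric (n : ℕ) (M : Type*) [TopologicalSpace M]
    [ChartedSpace (EuclideanSpace ℝ (Fin n)) M] [IsManifold (𝓡 n) ∞ M] where
  /-- The bilinear form `g_x`. -/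
  form (x : M) : TangentSpace (𝓡 n) x →L[ℝ] TangentSpace (𝓡 n) x →L[ℝ] ℝ
  symm (x : M) (v w : TangentSpace (𝓡 n) x) : form x v w = form x w v
  lorentzian (x : M) : ∃ v : TangentSpace (𝓡 n) x, form x v v < 0 ∧
    ∀ w : TangentSpace (𝓡 n) x, form x v w = 0 → w ≠ 0 → 0 < form x w w
  contMDiff : ContMDiff (𝓡 n)
    ((𝓡 n).prod 𝓘(ℝ, EuclideanSpace ℝ (Fin n) →L[ℝ] EuclideanSpace ℝ (Fin n) →L[ℝ] ℝ)) ∞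
    (fun x ↦ Bundle.TotalSpace.mk'
      (EuclideanSpace ℝ (Fin n) →L[ℝ] EuclideanSpace ℝ (Fin n) →L[ℝ] ℝ) x (form x))

/-- The filter of sets of full measure on a smooth manifold: `s` has full measure when the
complement of `s` is Lebesgue-null in every chart of the smooth structure. This is the
filter of almost every point for the density `√|det g| dx` of any smooth metric `g`. -/
def manifoldAE (n : ℕ) (M : Type*) [TopologicalSpace M]
    [ChartedSpace (EuclideanSpace ℝ (Fin n)) M] : Filter M where
  sets := {s | ∀ φ ∈ IsManifold.maximalAtlas (𝓡 n) ∞ M,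
    MeasureTheory.volume (φ '' (φ.source ∩ sᶜ)) = 0}
  univ_sets := by intro φ _; simp
  sets_of_superset := by
    intro s t hs hst φ hφ
    refine MeasureTheory.measure_mono_null (Set.image_mono ?_) (hs φ hφ)
    exact Set.inter_subset_inter_right _ (Set.compl_subset_compl.mpr hst)
  inter_sets := by
    intro s t hs ht φ hφ
    rw [Set.compl_inter, Set.inter_union_distrib_left, Set.image_union]
    exact MeasureTheory.measure_union_null (hs φ hφ) (ht φ hφ)

namespace LorentzianMetric

variable {n : ℕ} {M : Type*} [TopologicalSpace M]
  [ChartedSpace (EuclideanSpace ℝ (Fin n)) M] [IsManifold (𝓡 n) ∞ M]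

/-- The metric at a point as an algebraic bilinear form. -/
def bilin (g : LorentzianMetric n M) (x : M) :
    LinearMap.BilinForm ℝ (TangentSpace (𝓡 n) x) :=
  LinearMap.mk₂ ℝ (fun v w ↦ g.form x v w) (by simp) (by simp) (by simp) (by simp)

theorem bilin_nondegenerate (g : LorentzianMetric n M) (x : M) : (g.bilin x).Nondegenerate := by
  have key : ∀ w : TangentSpace (𝓡 n) x, (∀ v, g.form x v w = 0) → w = 0 := by
    intro w hw
    obtain ⟨v, -, hpos⟩ := g.lorentzian x
    by_contra hne
    exact absurd (hw w) (hpos w (hw v) hne).ne'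
  refine ⟨fun w hw ↦ key w fun v ↦ ?_, fun w hw ↦ key w fun v ↦ hw v⟩
  rw [g.symm]
  exact hw v

instance (x : M) : FiniteDimensional ℝ (TangentSpace (𝓡 n) x) :=
  inferInstanceAs (FiniteDimensional ℝ (EuclideanSpace ℝ (Fin n)))

/-- The differential of a real function at a point, as a linear form on the tangent space
(zero where the function is not differentiable). -/
def differential (f : M → ℝ) (x : M) : Module.Dual ℝ (TangentSpace (𝓡 n) x) :=
  (mfderiv (𝓡 n) 𝓘(ℝ, ℝ) f x : EuclideanSpace ℝ (Fin n) →L[ℝ] ℝ).toLinearMap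

/-- The gradient `∇f`, the vector with `g(∇f, v) = df(v)` for all `v`. -/
def gradient (g : LorentzianMetric n M) (f : M → ℝ) (x : M) : TangentSpace (𝓡 n) x :=
  ((g.bilin x).toDual (g.bilin_nondegenerate x)).symm (differential f x)

theorem form_gradient (g : LorentzianMetric n M) (f : M → ℝ) (x : M)
    (v : TangentSpace (𝓡 n) x) :
    g.form x (g.gradient f x) v = mfderiv (𝓡 n) 𝓘(ℝ, ℝ) f x v :=
  LinearMap.BilinForm.apply_toDual_symm_apply (hB := g.bilin_nondegenerate x)
    (f := differential f x) v

/-- The essential supremum over `M` of `g(∇f, ∇f)`, in the extended reals. -/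
def essSupGradient (g : LorentzianMetric n M) (f : M → ℝ) : EReal :=
  Filter.limsup (fun x ↦ ((g.form x (g.gradient f x) (g.gradient f x) : ℝ) : EReal))
    (manifoldAE n M)

/-- A time orientation of a Lorentzian manifold, given by a smooth timelike vector field `T`;
`(M, g)` is time-orientable when there is one. -/
structure TimeOrientation (g : LorentzianMetric n M) where
  /-- The vector field `T`. -/
  field (x : M) : TangentSpace (𝓡 n) x
  timelike (x : M) : g.form x (field x) (field x) < 0
  contMDiff : ContMDiff (𝓡 n) (𝓡 n).tangent ∞
    (fun x ↦ (⟨x, field x⟩ : TangentBundle (𝓡 n) M))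

/-- A piecewise smooth curve `γ : [a, b] → M` all of whose velocities (at the break points and at
the end points: all one-sided velocities) lie in the prescribed set `C` of tangent vectors.
Only the values of `γ` on `[a, b]` matter. -/
def IsPiecewiseSmoothCurve (C : ∀ x : M, Set (TangentSpace (𝓡 n) x)) (γ : ℝ → M) (a b : ℝ) :
    Prop :=
  ∃ (N : ℕ) (t : ℕ → ℝ), t 0 = a ∧ t N = b ∧ ∀ i < N, t i < t (i + 1) ∧
    ContMDiffOn 𝓘(ℝ, ℝ) (𝓡 n) ∞ γ (Set.Icc (t i) (t (i + 1))) ∧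
    ∀ s ∈ Set.Icc (t i) (t (i + 1)),
      mfderivWithin 𝓘(ℝ, ℝ) (𝓡 n) γ (Set.Icc (t i) (t (i + 1))) s 1 ∈ C (γ s)

variable {g : LorentzianMetric n M} (T : TimeOrientation g)

/-- The future directed timelike vectors at a point. -/
def futureTimelike (x : M) : Set (TangentSpace (𝓡 n) x) :=
  {v | g.form x v v < 0 ∧ g.form x v (T.field x) < 0}

/-- The future directed causal vectors at a point. (The condition `g(v, T) < 0` excludes the zero
vector, and selects one of the two halves of the set of nonzero causal vectors.) -/
def futureCausal (x : M) : Set (TangentSpace (𝓡 n) x) :=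
  {v | g.form x v v ≤ 0 ∧ g.form x v (T.field x) < 0}

/-- Future directed timelike piecewise smooth curves on `[a, b]`. -/
def IsTimelikeCurve (γ : ℝ → M) (a b : ℝ) : Prop :=
  IsPiecewiseSmoothCurve (futureTimelike T) γ a b

/-- Future directed causal piecewise smooth curves on `[a, b]`. -/
def IsCausalCurve (γ : ℝ → M) (a b : ℝ) : Prop :=
  IsPiecewiseSmoothCurve (futureCausal T) γ a b

/-- `p ⪯ q`: either `p = q`, or there is a future directed causal curve from `p` to `q`. -/
def CausalLE (p q : M) : Prop :=
  p = q ∨ ∃ γ : ℝ → M, IsCausalCurve T γ 0 1 ∧ γ 0 = p ∧ γ 1 = q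

/-- Strong causality: each point has arbitrarily small neighborhoods that are crossed at most once
by every timelike curve, in the sense that the curve meets the neighborhood in a connected set of
parameters. -/
def StronglyCausal : Prop :=
  ∀ p : M, ∀ U ∈ nhds p, ∃ V ∈ nhds p, V ⊆ U ∧
    ∀ (γ : ℝ → M) (a b : ℝ), IsTimelikeCurve T γ a b →
      (Set.Icc a b ∩ γ ⁻¹' V).OrdConnected

variable (g) in
/-- The length `∫₀¹ √(-g(γ', γ')) dt`, as an element of `[0, ∞]`. -/
def curveLength (γ : ℝ → M) : ENNReal :=
  ∫⁻ t in Set.Icc (0 : ℝ) 1, ENNReal.ofReal (Real.sqrt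
    (-g.form (γ t) (mfderiv 𝓘(ℝ, ℝ) (𝓡 n) γ t 1) (mfderiv 𝓘(ℝ, ℝ) (𝓡 n) γ t 1)))

/-- The Lorentzian distance: the supremum in `[0, ∞]` of the lengths of the future directed causal
piecewise smooth curves from `p` to `q`. It is `0` if there is no such curve. -/
def lorentzDist (p q : M) : ENNReal :=
  sSup {l | ∃ γ : ℝ → M, IsCausalCurve T γ 0 1 ∧ γ 0 = p ∧ γ 1 = q ∧ l = g.curveLength γ}

/-- Causal functions: the continuous real functions that are non-decreasing along every future
directed causal curve. -/
def IsCausalFunction (f : M → ℝ) : Prop :=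
  Continuous f ∧ ∀ (γ : ℝ → M) (a b : ℝ), IsCausalCurve T γ a b →
    MonotoneOn (f ∘ γ) (Set.Icc a b)

variable (g) in
/-- The condition `ess sup g(∇f, ∇f) ≤ -1`, where the gradient has to exist almost everywhere. -/
def EikonalInequality (f : M → ℝ) : Prop :=
  (∀ᶠ x in manifoldAE n M, MDifferentiableAt (𝓡 n) 𝓘(ℝ, ℝ) f x) ∧ g.essSupGradient f ≤ -1

end LorentzianMetric

end

/-! Fix `f` and a causal curve `γ`. As `f ∘ γ` is monotone, its derivative integrates to at most its
increment, so it suffices that `|γ'| ≤ (f ∘ γ)'` wherever `f ∘ γ` is differentiable. For null `γ'`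
this is monotonicity.

For timelike `γ'(t) = v` the difficulty is that the image of `γ` may lie in the null set where
nothing is known about `∇f`. Work in a chart. By Fubini almost every line of direction `v` meets
that set in a null set of parameters; on such a line reversed Cauchy–Schwarz bounds the derivative
of `f` below, hence its growth (`EikonalInequality.ae_le_sub_chart_segment`). Since all directions
near `v` are future timelike at all points near `γ(t)`, a good segment `[y, z]` of direction `v` can
be chosen with `γ(t) ≤ y ≤ z ≤ γ(t + δ)` causally, losing only a fraction `2ε` of the length
(`le_of_hasDerivAt_comp_of_ae_segment`). Letting `δ`, then `ε`, tend to `0` carries the bound over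
to `γ`. -/

noncomputable section

open MeasureTheory Set Filter Topology

/-! ### Monotone functions of one variable, and Fubini along lines -/

/-- The integral of a nonnegative minorant of the derivative of a monotone function is at most the
increment of the function. -/
theorem MonotoneOn.lintegral_ofReal_le_of_le_deriv {h L : ℝ → ℝ} {a b : ℝ} (hab : a ≤ b)
    (hmono : MonotoneOn h (Icc a b))
    (hL : ∀ t ∈ Ioo a b, DifferentiableAt ℝ h t → L t ≤ deriv h t) :
    ∫⁻ t in Icc a b, ENNReal.ofReal (L t) ≤ ENNReal.ofReal (h b - h a) := by
  have hmono' : MonotoneOn h (uIcc a b) := by rwa [uIcc_of_le hab]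
  have hint := hmono'.intervalIntegrable_deriv
  -- Only an inequality: jumps and singular parts of `h` are invisible to its derivative.
  have hle : ∫ t in a..b, deriv h t ≤ h b - h a := by
    have := hmono'.intervalIntegral_deriv_mem_uIcc
    rw [uIcc_of_le (sub_nonneg.2 (hmono (left_mem_Icc.2 hab) (right_mem_Icc.2 hab) hab))] at this
    exact this.2
  have hdiff : ∀ᵐ t, t ∈ Ioo a b → DifferentiableAt ℝ h t := by
    filter_upwards [(hmono.mono Ioo_subset_Icc_self).ae_differentiableWithinAt_of_mem] with t ht hmem
    exact (ht hmem).differentiableAt (Ioo_mem_nhds hmem.1 hmem.2)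
  have hnonneg : ∀ t ∈ Ioo a b, 0 ≤ deriv h t := fun t ht ↦ by
    by_cases hd : DifferentiableAt ℝ h t
    · rw [← hd.derivWithin (uniqueDiffOn_Icc (ht.1.trans ht.2) t (Ioo_subset_Icc_self ht))]
      exact hmono.derivWithin_nonneg
    · rw [deriv_zero_of_not_differentiableAt hd]
  calc ∫⁻ t in Icc a b, ENNReal.ofReal (L t)
      = ∫⁻ t in Ioo a b, ENNReal.ofReal (L t) := setLIntegral_congr Ioo_ae_eq_Icc.symm
    _ ≤ ∫⁻ t in Ioo a b, ENNReal.ofReal (deriv h t) := by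
        refine lintegral_mono_ae ((ae_restrict_iff' measurableSet_Ioo).2 ?_)
        filter_upwards [hdiff] with t ht hmem
        exact ENNReal.ofReal_le_ofReal (hL t hmem (ht hmem))
    _ = ENNReal.ofReal (∫ t in Ioo a b, deriv h t) := by
        refine (ofReal_integral_eq_lintegral_ofReal ?_
          ((ae_restrict_iff' measurableSet_Ioo).2 (.of_forall hnonneg))).symm
        exact ((intervalIntegrable_iff_integrableOn_Ioo_of_le hab).1 hint)
    _ = ENNReal.ofReal (∫ t in a..b, deriv h t) := by
        rw [intervalIntegral.integral_of_le hab, integral_Ioc_eq_integral_Ioo]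
    _ ≤ ENNReal.ofReal (h b - h a) := ENNReal.ofReal_le_ofReal hle

/-- A monotone function whose derivative is almost everywhere at least `c` grows at rate at least
`c`. -/
theorem MonotoneOn.mul_sub_le_of_ae_le_deriv {h : ℝ → ℝ} {a b c : ℝ} (hab : a ≤ b)
    (hmono : MonotoneOn h (Icc a b)) (hc : ∀ᵐ t, t ∈ Ioo a b → c ≤ deriv h t) :
    c * (b - a) ≤ h b - h a := by
  have hmono' : MonotoneOn h (uIcc a b) := by rwa [uIcc_of_le hab]
  have hle : ∫ t in a..b, deriv h t ≤ h b - h a := by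
    have := hmono'.intervalIntegral_deriv_mem_uIcc
    rw [uIcc_of_le (sub_nonneg.2 (hmono (left_mem_Icc.2 hab) (right_mem_Icc.2 hab) hab))] at this
    exact this.2
  refine le_trans ?_ hle
  have : ∫ _ in a..b, c ≤ ∫ t in a..b, deriv h t := by
    refine intervalIntegral.integral_mono_ae_restrict hab (by simp)
      hmono'.intervalIntegrable_deriv ?_
    rw [← restrict_Ioo_eq_restrict_Icc]
    exact (ae_restrict_iff' measurableSet_Ioo).2 hc
  simpa [mul_comm] using this

/-- Almost every line in a given direction meets a null set in a null set of parameters. -/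
theorem ae_ae_add_smul_notMem {E : Type*} [NormedAddCommGroup E] [NormedSpace ℝ E]
    [MeasurableSpace E] [BorelSpace E] [SecondCountableTopology E] (μ : Measure E) [SFinite μ]
    [μ.IsAddRightInvariant] (v : E) {N : Set E} (hN : μ N = 0) :
    ∀ᵐ y ∂μ, ∀ᵐ t : ℝ, y + t • v ∉ N := by
  -- Exchanging the quantifiers needs a measurable set, so `N` is enlarged to a measurable null set.
  have hmeas : MeasurableSet {p : ℝ × E | p.2 + p.1 • v ∉ toMeasurable μ N} :=
    (measurableSet_toMeasurable μ N).compl.preimage (by fun_prop)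
  have h := (Measure.ae_ae_comm (μ := (volume : Measure ℝ)) (ν := μ)
    (p := fun t y ↦ y + t • v ∉ toMeasurable μ N) hmeas).1 (.of_forall fun t ↦ by
      have := (measure_preimage_add_right μ (t • v) (toMeasurable μ N)).trans
        ((measure_toMeasurable N).trans hN)
      exact (measure_eq_zero_iff_ae_notMem).1 this)
  filter_upwards [h] with y hy
  filter_upwards [hy] with t ht using fun hmem ↦ ht (subset_toMeasurable μ N hmem)

/-! ### Reversed Cauchy–Schwarz -/

namespace LorentzianMetric

variable {n : ℕ} {M : Type*} [TopologicalSpace M]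
  [ChartedSpace (EuclideanSpace ℝ (Fin n)) M] [IsManifold (𝓡 n) ∞ M]

/-- The reversed Cauchy–Schwarz inequality for timelike vectors. -/
theorem form_mul_form_le_sq (g : LorentzianMetric n M) (x : M) {u w : TangentSpace (𝓡 n) x}
    (hw : g.form x w w < 0) :
    g.form x u u * g.form x w w ≤ g.form x u w ^ 2 := by
  obtain ⟨e, -, hpos⟩ := g.lorentzian x
  have hwe : g.form x e w ≠ 0 := fun h ↦ by
    have := hpos w h (by rintro rfl; simp at hw)
    linarith
  -- This `l` makes `u + l • w` orthogonal to `e`, hence spacelike or zero.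
  set l := -(g.form x e u / g.form x e w) with hl
  have horth : g.form x e (u + l • w) = 0 := by
    simp only [map_add, map_smul, smul_eq_mul, hl]
    field_simp
    ring
  have hnn : 0 ≤ g.form x (u + l • w) (u + l • w) := by
    by_cases h0 : u + l • w = 0
    · simp [h0]
    · exact (hpos _ horth h0).le
  have hexp : g.form x (u + l • w) (u + l • w) =
      g.form x u u + 2 * l * g.form x u w + l ^ 2 * g.form x w w := by
    simp only [map_add, map_smul, smul_eq_mul, add_apply,
      smul_apply, g.symm x w u]
    ring
  rw [hexp] at hnn
  -- Multiplying `hnn` by `g(w,w) < 0` and completing the square gives `g(u,u) g(w,w) - g(u,w)² + (l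
  -- g(w,w) + g(u,w))² ≤ 0`.
  nlinarith [sq_nonneg (l * g.form x w w + g.form x u w)]

end LorentzianMetric

/-! ### Joint continuity of the metric in chart coordinates -/

namespace LorentzianMetric

variable {n : ℕ} {M : Type*} [TopologicalSpace M]
  [ChartedSpace (EuclideanSpace ℝ (Fin n)) M] [IsManifold (𝓡 n) ∞ M]

/-- A tangent vector of the model space, pushed forward by the inverse of a chart. -/
def chartVec (φ : OpenPartialHomeomorph M (EuclideanSpace ℝ (Fin n)))
    (y a : EuclideanSpace ℝ (Fin n)) : TangentSpace (𝓡 n) (φ.symm y) :=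
  mfderiv (𝓡 n) (𝓡 n) φ.symm y a

/-- The map is the tangent map of `φ.symm`. Smoothness jointly in point and vector is what later
makes being future timelike an open condition on such pairs. -/
theorem contMDiffAt_chartVec {φ : OpenPartialHomeomorph M (EuclideanSpace ℝ (Fin n))}
    (hφ : φ ∈ IsManifold.maximalAtlas (𝓡 n) ∞ M)
    {p : TangentBundle (𝓡 n) (EuclideanSpace ℝ (Fin n))} (hp : p.proj ∈ φ.target) :
    ContMDiffAt (𝓡 n).tangent (𝓡 n).tangent ∞
      (fun p : TangentBundle (𝓡 n) (EuclideanSpace ℝ (Fin n)) ↦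
        (⟨φ.symm p.proj, chartVec φ p.proj p.2⟩ : TangentBundle (𝓡 n) M)) p := by
  have h1 : ContMDiffOn (𝓡 n) (𝓡 n) ∞ φ.symm φ.target := contMDiffOn_symm_of_mem_maximalAtlas hφ
  have h2 := h1.contMDiffOn_tangentMapWithin (m := ∞) (by simp) φ.open_target.uniqueMDiffOn
  have hmem : (Bundle.TotalSpace.proj ⁻¹' φ.target : Set (TangentBundle (𝓡 n)
      (EuclideanSpace ℝ (Fin n)))) ∈ 𝓝 p :=
    (φ.open_target.preimage (FiberBundle.continuous_proj _ _)).mem_nhds hp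
  refine (h2.contMDiffAt hmem).congr_of_eventuallyEq ?_
  filter_upwards [hmem] with q hq
  have : mfderivWithin (𝓡 n) (𝓡 n) φ.symm φ.target q.proj = mfderiv (𝓡 n) (𝓡 n) φ.symm q.proj :=
    mfderivWithin_of_isOpen φ.open_target hq
  simp only [tangentMapWithin, this, chartVec]

/-- The metric, evaluated on smooth vector fields along a chart, is a continuous function of the
coordinates of a point and of a tangent vector. -/
theorem continuousAt_form_of_contMDiffAt (g : LorentzianMetric n M)
    {φ : OpenPartialHomeomorph M (EuclideanSpace ℝ (Fin n))}
    (hφ : φ ∈ IsManifold.maximalAtlas (𝓡 n) ∞ M) {y a : EuclideanSpace ℝ (Fin n)}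
    (hy : y ∈ φ.target)
    {w : ∀ p : TangentBundle (𝓡 n) (EuclideanSpace ℝ (Fin n)), TangentSpace (𝓡 n) (φ.symm p.proj)}
    (hw : ContMDiffAt (𝓡 n).tangent (𝓡 n).tangent ∞
      (fun p : TangentBundle (𝓡 n) (EuclideanSpace ℝ (Fin n)) ↦
        (⟨φ.symm p.proj, w p⟩ : TangentBundle (𝓡 n) M)) ⟨y, a⟩) :
    ContinuousAt (fun p : EuclideanSpace ℝ (Fin n) × EuclideanSpace ℝ (Fin n) ↦
      g.form (φ.symm p.1) (chartVec φ p.1 p.2) (w ⟨p.1, p.2⟩)) (y, a) := by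
  have hv := contMDiffAt_chartVec hφ (p := ⟨y, a⟩) hy
  have hb := (Bundle.contMDiffAt_totalSpace.1 hv).1
  have : ContMDiffAt (𝓡 n).tangent ((𝓡 n).prod 𝓘(ℝ)) ∞
      (fun p : TangentBundle (𝓡 n) (EuclideanSpace ℝ (Fin n)) ↦
        Bundle.TotalSpace.mk' ℝ (E := Bundle.Trivial M ℝ) (φ.symm p.proj)
          (g.form (φ.symm p.proj) (chartVec φ p.proj p.2) (w p))) ⟨y, a⟩ :=
    ContMDiffAt.clm_bundle_apply₂ (F₁ := EuclideanSpace ℝ (Fin n))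
      (F₂ := EuclideanSpace ℝ (Fin n))
      (ContMDiffAt.comp (⟨y, a⟩ : TangentBundle (𝓡 n) (EuclideanSpace ℝ (Fin n)))
        g.contMDiff.contMDiffAt hb) hv hw
  have hc := (Bundle.contMDiffAt_totalSpace.1 this).2.continuousAt
  have hs := (tangentBundleModelSpaceHomeomorph (𝓡 n)).symm.continuous.continuousAt (x := (y, a))
  exact ContinuousAt.comp (f := (tangentBundleModelSpaceHomeomorph (𝓡 n)).symm) (x := (y, a)) hc hs

theorem continuousAt_form_chartVec (g : LorentzianMetric n M)
    {φ : OpenPartialHomeomorph M (EuclideanSpace ℝ (Fin n))}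
    (hφ : φ ∈ IsManifold.maximalAtlas (𝓡 n) ∞ M) {y : EuclideanSpace ℝ (Fin n)}
    (hy : y ∈ φ.target) (a : EuclideanSpace ℝ (Fin n)) :
    ContinuousAt (fun p : EuclideanSpace ℝ (Fin n) × EuclideanSpace ℝ (Fin n) ↦
      g.form (φ.symm p.1) (chartVec φ p.1 p.2) (chartVec φ p.1 p.2)) (y, a) :=
  g.continuousAt_form_of_contMDiffAt hφ hy (contMDiffAt_chartVec hφ (p := ⟨y, a⟩) hy)

theorem continuousAt_form_chartVec_field {g : LorentzianMetric n M} (T : TimeOrientation g)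
    {φ : OpenPartialHomeomorph M (EuclideanSpace ℝ (Fin n))}
    (hφ : φ ∈ IsManifold.maximalAtlas (𝓡 n) ∞ M) {y : EuclideanSpace ℝ (Fin n)}
    (hy : y ∈ φ.target) (a : EuclideanSpace ℝ (Fin n)) :
    ContinuousAt (fun p : EuclideanSpace ℝ (Fin n) × EuclideanSpace ℝ (Fin n) ↦
      g.form (φ.symm p.1) (chartVec φ p.1 p.2) (T.field (φ.symm p.1))) (y, a) :=
  g.continuousAt_form_of_contMDiffAt hφ hy (w := fun p ↦ T.field (φ.symm p.proj))
    (ContMDiffAt.comp (⟨y, a⟩ : TangentBundle (𝓡 n) (EuclideanSpace ℝ (Fin n)))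
      T.contMDiff.contMDiffAt
      (Bundle.contMDiffAt_totalSpace.1 (contMDiffAt_chartVec hφ (p := ⟨y, a⟩) hy)).1)

end LorentzianMetric

/-! ### From almost every segment to a given curve -/

/-- A function that is monotone in all directions close to `v`, and grows at rate at least `C` along
almost all segments of direction `v`, grows at rate at least `C` along any curve of velocity `v`. -/
theorem le_of_hasDerivAt_comp_of_ae_segment {E : Type*} [NormedAddCommGroup E] [NormedSpace ℝ E]
    [MeasurableSpace E] {μ : Measure E} [μ.IsOpenPosMeasure] {F : E → ℝ} {c : ℝ → E} {t d C r : ℝ}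
    {v : E} (hr : 0 < r)
    (hmono : ∀ y a : E, ∀ l : ℝ, 0 < l → y ∈ Metric.ball (c t) r → y + l • a ∈ Metric.ball (c t) r →
      a ∈ Metric.ball v r → F y ≤ F (y + l • a))
    (hae : ∀ᵐ y ∂μ, ∀ s : ℝ, 0 < s → y ∈ Metric.ball (c t) r → y + s • v ∈ Metric.ball (c t) r →
      C * s ≤ F (y + s • v) - F y)
    (hc : HasDerivAt c v t) (hd : HasDerivAt (fun s ↦ F (c s)) d t) : C ≤ d := by
  have key : ∀ ε ∈ Ioo (0 : ℝ) (1 / 2), C * (1 - 2 * ε) ≤ d := by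
    rintro ε ⟨hε, hε'⟩
    refine ge_of_tendsto hd.tendsto_slope_zero_right ?_
    have hsmall : ∀ᶠ δ in 𝓝[>] (0 : ℝ), δ * (‖v‖ + r) < r := by
      have : Tendsto (fun δ : ℝ ↦ δ * (‖v‖ + r)) (𝓝[>] 0) (𝓝 (0 * (‖v‖ + r))) :=
        ((continuous_id.mul continuous_const).tendsto 0).mono_left nhdsWithin_le_nhds
      rw [zero_mul] at this
      exact this.eventually (gt_mem_nhds hr)
    have hlin : ∀ᶠ δ in 𝓝[>] (0 : ℝ), ‖c (t + δ) - c t - δ • v‖ ≤ ε * r / 4 * ‖δ‖ :=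
      nhdsWithin_le_nhds ((hasDerivAt_iff_isLittleO_nhds_zero.1 hc).def (by positivity))
    filter_upwards [hsmall, hlin, self_mem_nhdsWithin] with δ hδs hδl (hδ : 0 < δ)
    rw [Real.norm_of_nonneg hδ.le] at hδl
    have hεδ : 0 < ε * δ := mul_pos hε hδ
    -- A ball has positive measure, so it contains a good starting point. Its radius, together with
    -- the error `ε * r / 4 * δ` of `hlin`, stays below the tolerance `ε * δ * r` of `hsub`.
    obtain ⟨y, hyball, hy⟩ : ∃ y ∈ Metric.ball (c t + (ε * δ) • v) (ε * δ * r / 2),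
        ∀ s : ℝ, 0 < s → y ∈ Metric.ball (c t) r → y + s • v ∈ Metric.ball (c t) r →
          C * s ≤ F (y + s • v) - F y := by
      have hpos : 0 < μ (Metric.ball (c t + (ε * δ) • v) (ε * δ * r / 2)) :=
        Metric.measure_ball_pos μ _ (by positivity)
      by_contra! hcon
      refine hpos.ne' (measure_mono_null (fun y hy ↦ ?_) (ae_iff.1 hae))
      obtain ⟨s, h1, h2, h3, h4⟩ := hcon y hy
      exact fun hgood ↦ absurd (hgood s h1 h2 h3) h4.not_ge
    have hyn : ‖y - c t - (ε * δ) • v‖ < ε * δ * r / 2 := by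
      rwa [Metric.mem_ball, dist_eq_norm, ← sub_sub] at hyball
    have hball : ∀ (w : E) (l : ℝ), 0 ≤ l → l ≤ δ → ‖w - c t - l • v‖ < δ * r →
        w ∈ Metric.ball (c t) r := fun w l hl hlδ hw ↦ by
      rw [Metric.mem_ball, dist_eq_norm]
      calc ‖w - c t‖ = ‖(w - c t - l • v) + l • v‖ := by rw [sub_add_cancel]
        _ ≤ ‖w - c t - l • v‖ + l * ‖v‖ := by
            refine (norm_add_le _ _).trans (add_le_add le_rfl ?_)
            rw [norm_smul, Real.norm_of_nonneg hl]
        _ ≤ δ * (‖v‖ + r) := by nlinarith [norm_nonneg v]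
        _ < r := hδs
    -- Divided by `ε * δ`, the displacement `w' - w` is within `r` of `v`, a direction in which `F`
    -- is monotone.
    have hsub : ∀ w w' : E, ‖w' - w - (ε * δ) • v‖ < ε * δ * r →
        w ∈ Metric.ball (c t) r → w' ∈ Metric.ball (c t) r → F w ≤ F w' := fun w w' h hw hw' ↦ by
      have hw'' : w + (ε * δ) • (ε * δ)⁻¹ • (w' - w) = w' := by
        rw [smul_inv_smul₀ hεδ.ne', add_sub_cancel]
      have := hmono w ((ε * δ)⁻¹ • (w' - w)) (ε * δ) hεδ hw (hw''.symm ▸ hw') ?_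
      · rwa [hw''] at this
      · rw [Metric.mem_ball, dist_eq_norm]
        have hv : (ε * δ)⁻¹ • (w' - w) - v = (ε * δ)⁻¹ • (w' - w - (ε * δ) • v) := by
          rw [smul_sub _ (w' - w), inv_smul_smul₀ hεδ.ne']
        rw [hv, norm_smul, Real.norm_of_nonneg (by positivity), inv_mul_lt_iff₀ hεδ]
        exact h
    -- A gap of about `(ε * δ) • v` remains at each end of the segment from `y` to `z`, to be
    -- bridged by `hsub`.
    set z := y + ((1 - 2 * ε) * δ) • v with hz
    have hr' : ε * δ * r < δ * r / 2 := by nlinarith [mul_pos hδ hr]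
    have hεr : 0 < ε * δ * r := by positivity
    have hctB : c t ∈ Metric.ball (c t) r := Metric.mem_ball_self hr
    have hyB : y ∈ Metric.ball (c t) r := hball y (ε * δ) hεδ.le (by nlinarith) (by linarith)
    have hzB : z ∈ Metric.ball (c t) r := by
      refine hball z ((1 - ε) * δ) (by nlinarith) (by nlinarith) ?_
      have : z - c t - ((1 - ε) * δ) • v = y - c t - (ε * δ) • v := by rw [hz]; module
      rw [this]; linarith
    have heB : c (t + δ) ∈ Metric.ball (c t) r :=
      hball _ δ hδ.le le_rfl (by nlinarith)
    have h1 : F (c t) ≤ F y := hsub _ _ (by linarith) hctB hyB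
    have h2 := hy ((1 - 2 * ε) * δ) (by nlinarith) hyB hzB
    have h3 : F z ≤ F (c (t + δ)) := by
      refine hsub _ _ ?_ hzB heB
      have : c (t + δ) - z - (ε * δ) • v =
          (c (t + δ) - c t - δ • v) - (y - c t - (ε * δ) • v) := by rw [hz]; module
      rw [this]
      refine (norm_sub_le _ _).trans_lt ?_
      linarith
    rw [smul_eq_mul, le_inv_mul_iff₀ hδ]
    linarith
  have hlim : Tendsto (fun ε : ℝ ↦ C * (1 - 2 * ε)) (𝓝[>] 0) (𝓝 (C * (1 - 2 * 0))) :=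
    (Continuous.tendsto (by fun_prop) 0).mono_left nhdsWithin_le_nhds
  rw [mul_zero, sub_zero, mul_one] at hlim
  refine le_of_tendsto hlim ?_
  filter_upwards [Ioo_mem_nhdsGT (show (0 : ℝ) < 1 / 2 by norm_num)] with ε hε using key ε hε

/-! ### Chart segments as causal curves, and the pointwise gradient bound -/

namespace LorentzianMetric

variable {n : ℕ} {M : Type*} [TopologicalSpace M]
  [ChartedSpace (EuclideanSpace ℝ (Fin n)) M]

theorem hasMFDerivAt_chart_segment {φ : OpenPartialHomeomorph M (EuclideanSpace ℝ (Fin n))}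
    (hφ : φ ∈ IsManifold.maximalAtlas (𝓡 n) ∞ M) {y a : EuclideanSpace ℝ (Fin n)} {s : ℝ}
    (hs : y + s • a ∈ φ.target) :
    HasMFDerivAt 𝓘(ℝ, ℝ) (𝓡 n) (fun s : ℝ ↦ φ.symm (y + s • a)) s
      ((mfderiv (𝓡 n) (𝓡 n) φ.symm (y + s • a)).comp
        (ContinuousLinearMap.toSpanSingleton ℝ a : ℝ →L[ℝ] EuclideanSpace ℝ (Fin n))) := by
  have h1 : MDifferentiableAt (𝓡 n) (𝓡 n) φ.symm (y + s • a) :=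
    ((contMDiffOn_symm_of_mem_maximalAtlas hφ).contMDiffAt
      (φ.open_target.mem_nhds hs)).mdifferentiableAt (by simp)
  have h2 : HasDerivAt (fun s : ℝ ↦ y + s • a) a s := by
    simpa using ((hasDerivAt_id s).smul_const a).const_add y
  exact h1.hasMFDerivAt.comp s h2.hasFDerivAt.hasMFDerivAt

variable [IsManifold (𝓡 n) ∞ M] {g : LorentzianMetric n M} {T : TimeOrientation g}

theorem isCausalCurve_chart_segment {φ : OpenPartialHomeomorph M (EuclideanSpace ℝ (Fin n))}
    (hφ : φ ∈ IsManifold.maximalAtlas (𝓡 n) ∞ M) {y a : EuclideanSpace ℝ (Fin n)} {l : ℝ}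
    (hl : 0 < l) (hmem : ∀ s ∈ Icc 0 l, y + s • a ∈ φ.target)
    (hcausal : ∀ s ∈ Icc 0 l,
      chartVec φ (y + s • a) a ∈ futureCausal T (φ.symm (y + s • a))) :
    IsCausalCurve T (fun s : ℝ ↦ φ.symm (y + s • a)) 0 l := by
  refine ⟨1, fun i ↦ i * l, by simp, by simp, fun i hi ↦ ?_⟩
  obtain rfl : i = 0 := by lia
  simp only [Nat.cast_zero, zero_mul, zero_add, Nat.cast_one, one_mul]
  refine ⟨hl, ?_, fun s hs ↦ ?_⟩
  · refine (contMDiffOn_symm_of_mem_maximalAtlas hφ).comp (t := φ.target) ?_ hmem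
    have : ContDiff ℝ ∞ (fun s : ℝ ↦ y + s • a) := by fun_prop
    exact this.contMDiff.contMDiffOn
  · have h := (hasMFDerivAt_chart_segment hφ (hmem s hs)).hasMFDerivWithinAt (s := Icc 0 l)
    rw [HasMFDerivWithinAt.mfderivWithin h (uniqueMDiffWithinAt_iff_uniqueDiffWithinAt.2 (uniqueDiffOn_Icc hl s hs))]
    convert hcausal s hs using 1
    change mfderiv (𝓡 n) (𝓡 n) φ.symm (y + s • a) ((1 : ℝ) • a) = _
    rw [one_smul, chartVec]

/-- A quantitative form of the reversed Cauchy–Schwarz inequality. -/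
theorem mul_le_form {x : M} {u w : TangentSpace (𝓡 n) x} {θ κ : ℝ} (hκ : 0 < κ)
    (hw : g.form x w w ≤ -κ ^ 2) (hu : g.form x u u ≤ -θ ^ 2) (hnn : 0 ≤ g.form x u w) :
    θ * κ ≤ g.form x u w := by
  refine le_of_sq_le_sq ?_ hnn
  refine le_trans ?_ (g.form_mul_form_le_sq x (u := u) (w := w) (by nlinarith))
  nlinarith [mul_nonneg (sub_nonneg.2 hu) (sq_nonneg κ), sq_nonneg θ, sq_nonneg κ]

/-- Up to a factor `θ < 1`, the eikonal inequality holds almost everywhere. -/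
theorem EikonalInequality.eventually {f : M → ℝ} (hf : g.EikonalInequality f) {θ : ℝ}
    (hθ : θ ∈ Ioo (0 : ℝ) 1) :
    ∀ᶠ x in manifoldAE n M, MDifferentiableAt (𝓡 n) 𝓘(ℝ, ℝ) f x ∧
      g.form x (g.gradient f x) (g.gradient f x) ≤ -θ ^ 2 := by
  -- A `limsup` bounds the function eventually only by numbers strictly above it. The slack `θ < 1`
  -- thus avoids any countable intersection property of `manifoldAE`.
  have hlt : g.essSupGradient f < ((-θ ^ 2 : ℝ) : EReal) := by
    refine hf.2.trans_lt ?_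
    have : (-1 : EReal) = ((-1 : ℝ) : EReal) := by norm_num
    rw [this, EReal.coe_lt_coe_iff]
    nlinarith [hθ.1, hθ.2]
  filter_upwards [hf.1, eventually_lt_of_limsup_lt hlt] with x h1 h2
  exact ⟨h1, (EReal.coe_lt_coe_iff.1 h2).le⟩

end LorentzianMetric

theorem HasMFDerivAt.hasDerivAt {E : Type*} [NormedAddCommGroup E] [NormedSpace ℝ E] {c : ℝ → E}
    {t : ℝ} {L : ℝ →L[ℝ] E} (h : HasMFDerivAt 𝓘(ℝ, ℝ) 𝓘(ℝ, E) c t L) : HasDerivAt c (L 1) t := by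
  have h' : HasFDerivAt c L t := h.hasFDerivAt
  exact h'.hasDerivAt

/-! ### Growth of causal functions in a chart -/

namespace LorentzianMetric

variable {n : ℕ} {M : Type*} [TopologicalSpace M]
  [ChartedSpace (EuclideanSpace ℝ (Fin n)) M]
variable [IsManifold (𝓡 n) ∞ M] {g : LorentzianMetric n M} {T : TimeOrientation g}

/-- Convexity keeps the segment inside `B`, where `a` is future causal, so the segment is a causal
curve. -/
theorem IsCausalFunction.monotoneOn_chart_segment {f : M → ℝ} (hf : IsCausalFunction T f)
    {φ : OpenPartialHomeomorph M (EuclideanSpace ℝ (Fin n))}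
    (hφ : φ ∈ IsManifold.maximalAtlas (𝓡 n) ∞ M) {B : Set (EuclideanSpace ℝ (Fin n))}
    (hB : Convex ℝ B) (hBφ : B ⊆ φ.target) {y a : EuclideanSpace ℝ (Fin n)} {l : ℝ} (hl : 0 < l)
    (hcausal : ∀ z ∈ B, chartVec φ z a ∈ futureCausal T (φ.symm z))
    (hy : y ∈ B) (hyl : y + l • a ∈ B) :
    (∀ s ∈ Icc 0 l, y + s • a ∈ B) ∧
      MonotoneOn (fun s : ℝ ↦ f (φ.symm (y + s • a))) (Icc 0 l) := by
  have hmem : ∀ s ∈ Icc 0 l, y + s • a ∈ B := fun s hs ↦ by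
    have := hB.add_smul_mem hy hyl (t := s / l)
      ⟨div_nonneg hs.1 hl.le, (div_le_one hl).2 hs.2⟩
    rwa [smul_smul, div_mul_cancel₀ _ hl.ne'] at this
  exact ⟨hmem, hf.2 _ 0 l (isCausalCurve_chart_segment hφ hl (fun s hs ↦ hBφ (hmem s hs))
    fun s hs ↦ hcausal _ (hmem s hs))⟩

/-- In a chart, a causal function satisfying the eikonal inequality grows at a rate that is bounded
below along almost every segment of a given timelike direction. -/
theorem EikonalInequality.ae_le_sub_chart_segment {f : M → ℝ} (hE : g.EikonalInequality f)
    (hf : IsCausalFunction T f) {φ : OpenPartialHomeomorph M (EuclideanSpace ℝ (Fin n))}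
    (hφ : φ ∈ IsManifold.maximalAtlas (𝓡 n) ∞ M) {B : Set (EuclideanSpace ℝ (Fin n))}
    (hB : Convex ℝ B) (hBφ : B ⊆ φ.target) {a : EuclideanSpace ℝ (Fin n)} {θ κ : ℝ}
    (hθ : θ ∈ Ioo (0 : ℝ) 1) (hκ : 0 < κ)
    (hcausal : ∀ z ∈ B, chartVec φ z a ∈ futureCausal T (φ.symm z))
    (hform : ∀ z ∈ B, g.form (φ.symm z) (chartVec φ z a) (chartVec φ z a) ≤ -κ ^ 2) :
    ∀ᵐ y, ∀ l : ℝ, 0 < l → y ∈ B → y + l • a ∈ B →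
      θ * κ * l ≤ f (φ.symm (y + l • a)) - f (φ.symm y) := by
  -- By definition of `manifoldAE`, the chart image of the bad set is Lebesgue-null.
  filter_upwards [ae_ae_add_smul_notMem volume a (hE.eventually hθ φ hφ)] with y hy l hl hyB hylB
  obtain ⟨hmem, hmono⟩ := hf.monotoneOn_chart_segment hφ hB hBφ hl hcausal hyB hylB
  have := hmono.mul_sub_le_of_ae_le_deriv (c := θ * κ) hl.le ?_
  · simpa using this
  filter_upwards [hy] with s hs hsl
  have hsB := hmem s (Ioo_subset_Icc_self hsl)
  have hgood : MDifferentiableAt (𝓡 n) 𝓘(ℝ, ℝ) f (φ.symm (y + s • a)) ∧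
      g.form (φ.symm (y + s • a)) (g.gradient f (φ.symm (y + s • a)))
        (g.gradient f (φ.symm (y + s • a))) ≤ -θ ^ 2 := by
    by_contra hbad
    exact hs ⟨_, ⟨φ.map_target (hBφ hsB), hbad⟩, φ.right_inv (hBφ hsB)⟩
  have hderiv : HasDerivAt (fun s : ℝ ↦ f (φ.symm (y + s • a)))
      (g.form (φ.symm (y + s • a)) (g.gradient f (φ.symm (y + s • a)))
        (chartVec φ (y + s • a) a)) s := by
    refine (HasMFDerivAt.comp s hgood.1.hasMFDerivAt
      (hasMFDerivAt_chart_segment hφ (hBφ hsB))).hasDerivAt.congr_deriv ?_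
    rw [form_gradient]
    change mfderiv (𝓡 n) 𝓘(ℝ, ℝ) f (φ.symm (y + s • a))
      (mfderiv (𝓡 n) (𝓡 n) φ.symm (y + s • a) ((1 : ℝ) • a)) = _
    rw [one_smul, chartVec]
  rw [hderiv.deriv]
  refine mul_le_form hκ (hform _ hsB) hgood.2 ?_
  -- The gradient bound leaves the sign of `g(∇f, a)` open; monotonicity along the segment fixes it.
  rw [← hderiv.deriv, ← hderiv.differentiableAt.derivWithin
    (uniqueDiffOn_Icc hl s (Ioo_subset_Icc_self hsl))]
  exact hmono.derivWithin_nonneg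

/-- The derivative of a causal function satisfying the eikonal inequality along a curve in a chart
with timelike velocity is at least the length of the velocity. -/
theorem EikonalInequality.sqrt_le_of_hasDerivAt_chart {f : M → ℝ} (hE : g.EikonalInequality f)
    (hf : IsCausalFunction T f) {φ : OpenPartialHomeomorph M (EuclideanSpace ℝ (Fin n))}
    (hφ : φ ∈ IsManifold.maximalAtlas (𝓡 n) ∞ M) {c : ℝ → EuclideanSpace ℝ (Fin n)}
    {v : EuclideanSpace ℝ (Fin n)} {t d : ℝ} (hct : c t ∈ φ.target)
    (hv : chartVec φ (c t) v ∈ futureTimelike T (φ.symm (c t))) (hc : HasDerivAt c v t)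
    (hd : HasDerivAt (fun s ↦ f (φ.symm (c s))) d t) :
    √(-g.form (φ.symm (c t)) (chartVec φ (c t) v) (chartVec φ (c t) v)) ≤ d := by
  set L := √(-g.form (φ.symm (c t)) (chartVec φ (c t) v) (chartVec φ (c t) v)) with hL
  have hLpos : 0 < L := Real.sqrt_pos.2 (neg_pos.2 hv.1)
  have hLsq : L ^ 2 = -g.form (φ.symm (c t)) (chartVec φ (c t) v) (chartVec φ (c t) v) :=
    Real.sq_sqrt (neg_pos.2 hv.1).le
  -- One factor `θ` is lost in the gradient bound, the other in bounding the length of `v` below by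
  -- `θ * L` at all nearby points.
  have key : ∀ θ ∈ Ioo (0 : ℝ) 1, θ * (θ * L) ≤ d := by
    intro θ hθ
    have hκ : 0 < θ * L := mul_pos hθ.1 hLpos
    have hlt : g.form (φ.symm (c t)) (chartVec φ (c t) v) (chartVec φ (c t) v) < -(θ * L) ^ 2 := by
      have : θ ^ 2 < 1 := by nlinarith [hθ.1, hθ.2]
      nlinarith [mul_pos hLpos hLpos]
    -- The strict inequalities of a timelike `v` persist for nearby points and directions; a null
    -- `v` would not allow this.
    have hev : ∀ᶠ p in 𝓝 (c t, v), p.1 ∈ φ.target ∧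
        g.form (φ.symm p.1) (chartVec φ p.1 p.2) (chartVec φ p.1 p.2) < -(θ * L) ^ 2 ∧
        g.form (φ.symm p.1) (chartVec φ p.1 p.2) (T.field (φ.symm p.1)) < 0 :=
      (continuousAt_fst.eventually (φ.open_target.mem_nhds hct)).and
        (((g.continuousAt_form_chartVec hφ hct v).eventually (gt_mem_nhds hlt)).and
          ((continuousAt_form_chartVec_field T hφ hct v).eventually (gt_mem_nhds hv.2)))
    obtain ⟨r, hr, hball⟩ := Metric.eventually_nhds_iff_ball.1 hev
    have hball' : ∀ z ∈ Metric.ball (c t) r, ∀ a ∈ Metric.ball v r, z ∈ φ.target ∧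
        g.form (φ.symm z) (chartVec φ z a) (chartVec φ z a) < -(θ * L) ^ 2 ∧
        g.form (φ.symm z) (chartVec φ z a) (T.field (φ.symm z)) < 0 := fun z hz a ha ↦
      hball (z, a) (by rw [← ball_prod_same]; exact ⟨hz, ha⟩)
    have hvr := Metric.mem_ball_self (x := v) hr
    have hBφ : Metric.ball (c t) r ⊆ φ.target := fun z hz ↦ (hball' z hz v hvr).1
    have hcausal : ∀ a ∈ Metric.ball v r, ∀ z ∈ Metric.ball (c t) r,
        chartVec φ z a ∈ futureCausal T (φ.symm z) := fun a ha z hz ↦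
      ⟨(hball' z hz a ha).2.1.le.trans (by nlinarith), (hball' z hz a ha).2.2⟩
    refine le_of_hasDerivAt_comp_of_ae_segment (μ := volume) (F := fun z ↦ f (φ.symm z)) hr ?_
      (hE.ae_le_sub_chart_segment hf hφ (convex_ball _ _) hBφ hθ hκ (hcausal v hvr)
        fun z hz ↦ (hball' z hz v hvr).2.1.le) hc hd
    intro y a l hl hy hyl ha
    have := (hf.monotoneOn_chart_segment hφ (convex_ball _ _) hBφ hl (hcausal a ha) hy hyl).2
      (left_mem_Icc.2 hl.le) (right_mem_Icc.2 hl.le) hl.le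
    simpa using this
  have hlim : Tendsto (fun θ : ℝ ↦ θ * (θ * L)) (𝓝[<] 1) (𝓝 (1 * (1 * L))) :=
    (Continuous.tendsto (by fun_prop) 1).mono_left nhdsWithin_le_nhds
  rw [one_mul, one_mul] at hlim
  refine le_of_tendsto hlim ?_
  filter_upwards [Ioo_mem_nhdsLT (zero_lt_one (α := ℝ))] with θ hθ using key θ hθ

/-! ### From charts to curves and their lengths -/

/-- The derivative of a causal function satisfying the eikonal inequality along a curve with
timelike velocity is at least the length of the velocity. -/
theorem EikonalInequality.sqrt_le_deriv_comp {f : M → ℝ} (hE : g.EikonalInequality f)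
    (hf : IsCausalFunction T f) {γ : ℝ → M} {t : ℝ}
    (hγ : MDifferentiableAt 𝓘(ℝ, ℝ) (𝓡 n) γ t)
    (hv : mfderiv 𝓘(ℝ, ℝ) (𝓡 n) γ t 1 ∈ futureTimelike T (γ t))
    (hd : DifferentiableAt ℝ (f ∘ γ) t) :
    √(-g.form (γ t) (mfderiv 𝓘(ℝ, ℝ) (𝓡 n) γ t 1) (mfderiv 𝓘(ℝ, ℝ) (𝓡 n) γ t 1)) ≤
      deriv (f ∘ γ) t := by
  set φ := chartAt (EuclideanSpace ℝ (Fin n)) (γ t) with hφdef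
  have hφ : φ ∈ IsManifold.maximalAtlas (𝓡 n) ∞ M := IsManifold.chart_mem_maximalAtlas _
  have hsrc : γ t ∈ φ.source := mem_chart_source _ _
  have hφd : φ.MDifferentiable (𝓡 n) (𝓡 n) := mdifferentiable_chart (γ t)
  set v : EuclideanSpace ℝ (Fin n) :=
    mfderiv (𝓡 n) (𝓡 n) φ (γ t) (mfderiv 𝓘(ℝ, ℝ) (𝓡 n) γ t 1) with hvdef
  have hc : HasDerivAt (fun s ↦ φ (γ s)) v t :=
    (HasMFDerivAt.comp t (hφd.mdifferentiableAt hsrc).hasMFDerivAt hγ.hasMFDerivAt).hasDerivAt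
  have hvec : (chartVec φ (φ (γ t)) v : EuclideanSpace ℝ (Fin n)) =
      mfderiv 𝓘(ℝ, ℝ) (𝓡 n) γ t 1 :=
    congrArg (fun L : EuclideanSpace ℝ (Fin n) →L[ℝ] EuclideanSpace ℝ (Fin n) ↦
      L (mfderiv 𝓘(ℝ, ℝ) (𝓡 n) γ t 1)) (hφd.symm_comp_deriv hsrc)
  -- The base points `φ.symm (φ (γ t))` and `γ t` are equal only propositionally; with free
  -- variables the dependent rewrite becomes a substitution.
  have hform : ∀ (x x' : M) (u u' : EuclideanSpace ℝ (Fin n)), x = x' → u = u' →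
      g.form x u u = g.form x' u' u' ∧
        g.form x u (T.field x) = g.form x' u' (T.field x') := by
    rintro x _ u _ rfl rfl
    exact ⟨rfl, rfl⟩
  obtain ⟨h1, h2⟩ := hform _ _ _ _ (φ.left_inv hsrc) hvec
  have hd' : HasDerivAt (fun s ↦ f (φ.symm (φ (γ s)))) (deriv (f ∘ γ) t) t := by
    refine hd.hasDerivAt.congr_of_eventuallyEq ?_
    filter_upwards [hγ.continuousAt.eventually (φ.open_source.mem_nhds hsrc)] with s hs
    rw [φ.left_inv hs, Function.comp]
  have hmain := hE.sqrt_le_of_hasDerivAt_chart hf hφ (c := fun s ↦ φ (γ s)) (φ.map_source hsrc)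
    ⟨h1.trans_lt hv.1, h2.trans_lt hv.2⟩ hc hd'
  have h1' := congrArg (fun r ↦ √(-r)) h1
  exact h1'.symm.le.trans hmain

/-- The Lorentzian length of a smooth causal arc is at most the increment of a causal function
satisfying the eikonal inequality. -/
theorem EikonalInequality.lintegral_arc_le {f : M → ℝ} (hE : g.EikonalInequality f)
    (hf : IsCausalFunction T f) {γ : ℝ → M} {a b : ℝ} (hab : a < b)
    (hγ : ContMDiffOn 𝓘(ℝ, ℝ) (𝓡 n) ∞ γ (Icc a b))
    (hv : ∀ s ∈ Icc a b, mfderivWithin 𝓘(ℝ, ℝ) (𝓡 n) γ (Icc a b) s 1 ∈ futureCausal T (γ s)) :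
    f (γ a) ≤ f (γ b) ∧
    ∫⁻ t in Icc a b, ENNReal.ofReal (√(-g.form (γ t) (mfderiv 𝓘(ℝ, ℝ) (𝓡 n) γ t 1)
      (mfderiv 𝓘(ℝ, ℝ) (𝓡 n) γ t 1))) ≤ ENNReal.ofReal (f (γ b) - f (γ a)) := by
  have hcurve : IsCausalCurve T γ a b := by
    refine ⟨1, fun i ↦ if i = 0 then a else b, by simp, by simp, fun i hi ↦ ?_⟩
    obtain rfl : i = 0 := by lia
    simpa using ⟨hab, hγ, fun s h1 h2 ↦ hv s ⟨h1, h2⟩⟩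
  have hmono := hf.2 γ a b hcurve
  refine ⟨hmono (left_mem_Icc.2 hab.le) (right_mem_Icc.2 hab.le) hab.le, ?_⟩
  refine hmono.lintegral_ofReal_le_of_le_deriv hab.le fun t ht hd ↦ ?_
  have hnhds : Icc a b ∈ 𝓝 t := Icc_mem_nhds ht.1 ht.2
  have hvt := hv t (Ioo_subset_Icc_self ht)
  rw [mfderivWithin_of_mem_nhds hnhds] at hvt
  rcases hvt.1.lt_or_eq with hlt | heq
  · exact hE.sqrt_le_deriv_comp hf ((hγ.contMDiffAt hnhds).mdifferentiableAt (by simp))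
      ⟨hlt, hvt.2⟩ hd
  -- For a null velocity the integrand vanishes and monotonicity suffices.
  · rw [heq, neg_zero, Real.sqrt_zero, ← hd.derivWithin
      (uniqueDiffOn_Icc hab t (Ioo_subset_Icc_self ht))]
    exact hmono.derivWithin_nonneg

/-- The Lorentzian length of a causal curve is at most the increment of a causal function
satisfying the eikonal inequality. -/
theorem EikonalInequality.curveLength_le {f : M → ℝ} (hE : g.EikonalInequality f)
    (hf : IsCausalFunction T f) {γ : ℝ → M} (hγ : IsCausalCurve T γ 0 1) :
    g.curveLength γ ≤ ENNReal.ofReal (f (γ 1) - f (γ 0)) := by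
  obtain ⟨N, t, h0, hN, ht⟩ := hγ
  have key : ∀ k ≤ N, t 0 ≤ t k ∧ f (γ (t 0)) ≤ f (γ (t k)) ∧
      ∫⁻ s in Icc (t 0) (t k), ENNReal.ofReal (√(-g.form (γ s) (mfderiv 𝓘(ℝ, ℝ) (𝓡 n) γ s 1)
        (mfderiv 𝓘(ℝ, ℝ) (𝓡 n) γ s 1))) ≤ ENNReal.ofReal (f (γ (t k)) - f (γ (t 0))) := by
    intro k
    induction k with
    | zero => simp
    | succ k ih =>
      intro hk
      obtain ⟨hle, hfle, hint⟩ := ih (by lia)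
      obtain ⟨hlt, hsmooth, hvel⟩ := ht k (by lia)
      obtain ⟨hfle', hint'⟩ := hE.lintegral_arc_le hf hlt hsmooth hvel
      refine ⟨hle.trans hlt.le, hfle.trans hfle', ?_⟩
      -- Subadditivity is enough, so the shared break point does no harm.
      rw [← Icc_union_Icc_eq_Icc hle hlt.le]
      refine (lintegral_union_le _ _ _).trans ((add_le_add hint hint').trans_eq ?_)
      rw [← ENNReal.ofReal_add (sub_nonneg.2 hfle) (sub_nonneg.2 hfle')]
      congr 1
      ring
  have := (key N le_rfl).2.2
  rwa [h0, hN] at this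

end LorentzianMetric

end

theorem mainTheorem2 {n : ℕ} {M : Type*} [TopologicalSpace M] [T2Space M]
    [SecondCountableTopology M] [ChartedSpace (EuclideanSpace ℝ (Fin n)) M]
    [IsManifold (𝓡 n) ∞ M] (g : LorentzianMetric n M) (T : g.TimeOrientation)
    (hM : LorentzianMetric.StronglyCausal T) (p q : M) (hpq : LorentzianMetric.CausalLE T p q) :
    (LorentzianMetric.lorentzDist T p q : EReal) ≤
      sInf {r : EReal | ∃ f : M → ℝ, LorentzianMetric.IsCausalFunction T f ∧
        g.EikonalInequality f ∧ r = ((f q - f p : ℝ) : EReal)} := by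
  refine le_sInf ?_
  rintro _ ⟨f, hf, hE, rfl⟩
  -- `ENNReal.ofReal` truncates at `0`, so nonnegativity is needed to identify it with `f q - f p`.
  have hpqf : f p ≤ f q := by
    rcases hpq with rfl | ⟨γ, hγ, rfl, rfl⟩
    · exact le_rfl
    · exact hf.2 γ 0 1 hγ (by simp) (by simp) zero_le_one
  rw [← max_eq_left (sub_nonneg.2 hpqf), ← EReal.coe_ennreal_ofReal,
    EReal.coe_ennreal_le_coe_ennreal_iff]
  refine sSup_le ?_
  rintro _ ⟨γ, hγ, rfl, rfl, rfl⟩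
  exact hE.curveLength_le hf hγ
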